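/- Let $\kappa$ be an infinite cardinal, let $T$ be a complete first-order theory in a language $L$ with $|T|\le\kappa$ (that is, $|L|+\aleph_0\le\kappa$), let $\mathcal U$ be a monster model of $T$ (that is, $\kappa^+$-saturated and strongly $\kappa^+$-homogeneous: any two tuples of length at most $\kappa$ with the same type over $\emptyset$ are conjugate under $\mathrm{Aut}(\mathcal U)$), and let $M\preceq\mathcal U$ be an elementary submodel with $|M|\le\kappa$. Let $x,y$ be finite tuples of variables and let $\phi(x;y)$ be an $L$-formula that is NIP: there do not exist an infinite set $A$ of $|x|$-tuples of $\mathcal U$ and, for each $I\subseteq A$, a $|y|$-tuple $b_I$ of $\mathcal U$ such that for all $a\in A$, $\mathcal U\models\phi(a;b_I)\iff a\in I$. A global $\phi$-type is a complete set of formulas of the form $\phi(x;b)$ or $\neg\phi(x;b)$, with $b$ in $\mathcal U$, that is finitely satisfiable in $\mathcal U$; it is $M$-invariant if it is fixed by all automorphisms of $\mathcal U$ that fix $M$ pointwise. Let $S_y(M)$ be the space of complete types over $M$ in the variables $y$, with its usual (Stone) topology. For a topological space $X$, let $B^{\S}(X)$ be the set of functions $f:X\to\{0,1\}$ such that $\overline{f^{-1}(0)}\cap\overline{f^{-1}(1)}$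 has empty interior, and let $B_r^{\S}(X)$ be the set of functions $f:X\to\{0,1\}$ such that $f|_F\in B^{\S}(F)$ for every nonempty closed $F\subseteq X$, where $F$ carries the subspace topology. Let $p$ be a global $M$-invariant $\phi$-type, and define $d_p:S_y(M)\to\{0,1\}$ by $d_p(q)=1$ if $p\vdash\phi(x;b)$ for some $b$ in $\mathcal U$ realizing $q$, and $d_p(q)=0$ otherwise. Then: 1. Every $q\in S_y(M)$ is realized in $\mathcal U$, and for every $b$ in $\mathcal U$ realizing $q$, $d_p(q)=1$ if and only if $p\vdash\phi(x;b)$. 2. $d_p\in B_r^{\S}(S_y(M))$. 3. (Borel definability) If moreover $L$ and $M$ are countable, then $\{q\in S_y(M): p\vdash\phi(x;b)\text{ for } b\in\mathcal U \text{ realizing } q\}$ is both an $F_\sigma$ and a $G_\delta$ subset of $S_y(M)$. -/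

import Mathlib

open FirstOrder Cardinal

universe u v w

/-! ### The classes `B^§` and `B_r^§` of two-valued functions; `0` is `false`, `1` is `true` -/

/-- `B^§(X)`: the functions `f : X → {0,1}` for which the intersection of the closures of
`f⁻¹(0)` and `f⁻¹(1)` has empty interior. -/
def BSec (X : Type*) [TopologicalSpace X] : Set (X → Bool) :=
  {f | interior (closure (f ⁻¹' {false}) ∩ closure (f ⁻¹' {true})) = ∅}

/-- `B_r^§(X)`: the functions `f : X → {0,1}` whose restriction to every nonempty closed
subset `F` of `X` (with the subspace topology) is in `B^§(F)`. -/
def BrSec (X : Type*) [TopologicalSpace X] : Set (X → Bool) :=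
  {f | ∀ F : Set X, IsClosed F → F.Nonempty → F.domRestrict f ∈ BSec F}

/-- An `F_σ` set: a countable union of closed sets. -/
def IsFSigma {X : Type*} [TopologicalSpace X] (S : Set X) : Prop :=
  ∃ C : ℕ → Set X, (∀ i, IsClosed (C i)) ∧ S = ⋃ i, C i

section ModelTheory

variable {L : FirstOrder.Language.{u, v}} {U : Type w} [L.Structure U]

variable (L U) in
/-- `κ⁺`-saturation: for every set `A` of at most `κ` parameters, every set of formulas over `A`
in finitely many variables that is finitely satisfiable in `U` is realized in `U`. -/
def IsSaturatedAbove (κ : Cardinal.{w}) : Prop :=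
  ∀ A : Set U, #A ≤ κ → ∀ (n : ℕ) (S : Set (L[[A]].Formula (Fin n))),
    (∀ S₀ : Finset (L[[A]].Formula (Fin n)), (S₀ : Set (L[[A]].Formula (Fin n))) ⊆ S →
      ∃ c : Fin n → U, ∀ ψ ∈ S₀, ψ.Realize c) →
    ∃ c : Fin n → U, ∀ ψ ∈ S, ψ.Realize c

variable (L U) in
/-- Strong `κ⁺`-homogeneity: two tuples of length at most `κ` with the same type over `∅` are
conjugate under the automorphism group of `U`. -/
def IsStronglyHomogeneousAbove (κ : Cardinal.{w}) : Prop :=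
  ∀ ι : Type w, #ι ≤ κ → ∀ a b : ι → U,
    (∀ ψ : L.Formula ι, ψ.Realize a ↔ ψ.Realize b) → ∃ σ : U ≃[L] U, ∀ i, σ (a i) = b i

variable (L U) in
/-- `U` is a monster model with respect to sets of size at most `κ`. -/
structure IsMonster (κ : Cardinal.{w}) : Prop where
  saturated : IsSaturatedAbove L U κ
  homogeneous : IsStronglyHomogeneousAbove L U κ

/-- `φ(x; y)` is NIP (in the monster model `U`): there are no infinite set `A` of `|x|`-tuples and
`|y|`-tuples `b_I`, for `I ⊆ A`, such that `φ(a; b_I)` holds exactly when `a ∈ I`, for `a ∈ A`. -/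
def IsNIP {m n : ℕ} (φ : L.Formula (Fin m ⊕ Fin n)) (U : Type w) [L.Structure U] : Prop :=
  ¬ ∃ A : Set (Fin m → U), A.Infinite ∧ ∀ I : Set (Fin m → U), I ⊆ A →
    ∃ b : Fin n → U, ∀ a ∈ A, φ.Realize (Sum.elim a b) ↔ a ∈ I

/-- A global `φ`-type: a complete consistent set of formulas `φ(x; b)`, `¬ φ(x; b)` with
`b` from `U`. The pair `(b, true)` stands for `φ(x; b)` and `(b, false)` for `¬ φ(x; b)`. -/
structure PhiType {m n : ℕ} (φ : L.Formula (Fin m ⊕ Fin n)) (U : Type w) [L.Structure U] where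
  /-- the formulas in the type -/
  carrier : Set ((Fin n → U) × Bool)
  /-- every finite part of the type is satisfied by some tuple of `U` -/
  consistent : ∀ S₀ : Finset ((Fin n → U) × Bool), (S₀ : Set ((Fin n → U) × Bool)) ⊆ carrier →
    ∃ a : Fin m → U, ∀ c ∈ S₀, φ.Realize (Sum.elim a c.1) ↔ c.2 = true
  /-- for each `b`, one of `φ(x; b)` and `¬ φ(x; b)` is in the type -/
  complete : ∀ b : Fin n → U, (b, true) ∈ carrier ∨ (b, false) ∈ carrier

/-- `p ⊢ φ(x; b)`. -/
def PhiType.Entails {m n : ℕ} {φ : L.Formula (Fin m ⊕ Fin n)} (p : PhiType φ U)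
    (b : Fin n → U) : Prop :=
  (b, true) ∈ p.carrier

/-- `p` is `A`-invariant: it is fixed by every automorphism of `U` that fixes `A` pointwise. -/
def PhiType.IsInvariant {m n : ℕ} {φ : L.Formula (Fin m ⊕ Fin n)} (p : PhiType φ U)
    (A : Set U) : Prop :=
  ∀ σ : U ≃[L] U, (∀ a ∈ A, σ a = a) →
    ∀ (b : Fin n → U) (ε : Bool), (b, ε) ∈ p.carrier ↔ (σ ∘ b, ε) ∈ p.carrier

variable (L) in
/-- `S_y(A)` for `|y| = n`: the space of complete types over the parameter set `A ⊆ U`, that is,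
of complete types of the theory of `U` with constants for `A`. It carries the usual (Stone)
topology, generated by the sets of types containing a given formula. -/
abbrev TypesOver (A : Set U) (n : ℕ) := (L[[A]].completeTheory U).CompleteType (Fin n)

variable [Nonempty U]

variable (L) in
/-- The complete type `tp(b/A)`. -/
def tpOver (A : Set U) {n : ℕ} (b : Fin n → U) : TypesOver L A n :=
  (L[[A]].completeTheory U).typeOf b

open Classical in
/-- The definition function `d_p : S_y(A) → {0,1}` of a `φ`-type `p`: its value at `q` is `1` if
`p ⊢ φ(x; b)` for some `b` in `U` realizing `q`, and `0` otherwise. -/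
noncomputable def PhiType.defFun {m n : ℕ} {φ : L.Formula (Fin m ⊕ Fin n)} (p : PhiType φ U)
    (A : Set U) (q : TypesOver L A n) : Bool :=
  decide (∃ b : Fin n → U, tpOver L A b = q ∧ p.Entails b)

end ModelTheory

/-! ### Topology of the class `BrSec`. -/

section Topology

variable {X : Type*} [TopologicalSpace X]

/-! By homogeneity and invariance, whether `p` entails `φ(x; b)` depends only on the type of `b`
over `M`. If `d_p` is not in `BrSec`, some nonempty set `G` of types has both fibres of `d_p` dense
in it. A finite set `s` of `x`-tuples is then grown so that every type in `G` stays compatible with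
every `φ`-pattern on `s`. The new tuple `a` realizes `p` on a small family of tuples `b`, so the
truth of `φ(a; b)` is the value of `d_p` at the type of `b`, which density allows to be chosen
freely (`PatternsCompatible.exists_insert`). In the limit, saturation gives an infinite shattered
set, contradicting NIP (`IsNIP.mem_BrSec`). Borel definability is then purely topological: in the
countable case `S_y(M)` has a countable clopen basis, and `isGδ_fibres_of_mem_BrSec` applies. -/

theorem isFSigma_iff_isGδ_compl {S : Set X} : IsFSigma S ↔ IsGδ Sᶜ := by
  rw [isGδ_iff_eq_iInter_nat]
  constructor
  · rintro ⟨C, hC, rfl⟩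
    exact ⟨fun i => (C i)ᶜ, fun i => (hC i).isOpen_compl, Set.compl_iUnion C⟩
  · rintro ⟨C, hC, h⟩
    exact ⟨fun i => (C i)ᶜ, fun i => (hC i).isClosed_compl, by
      rw [← Set.compl_iInter, ← h, compl_compl]⟩

/-- A failure of `B_r^§` produces a nonempty closed set on which both fibres are dense. -/
theorem exists_isClosed_dense_fibres_of_notMem_BrSec {f : X → Bool} (hf : f ∉ BrSec X) :
    ∃ G : Set X, IsClosed G ∧ G.Nonempty ∧ ∀ ε, G ⊆ closure (G ∩ f ⁻¹' {ε}) := by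
  simp only [BrSec, Set.mem_ofPred_eq, not_forall] at hf
  obtain ⟨F, hF, -, hB⟩ := hf
  rw [BSec, Set.mem_ofPred_eq, ← ne_eq, ← Set.nonempty_iff_ne_empty] at hB
  set V : Set F := interior (closure (F.domRestrict f ⁻¹' {false}) ∩
    closure (F.domRestrict f ⁻¹' {true}))
  have hVo : IsOpen V := isOpen_interior
  have hVε : ∀ ε, V ⊆ closure (F.domRestrict f ⁻¹' {ε}) := by
    rintro (_ | _)
    · exact interior_subset.trans Set.inter_subset_left
    · exact interior_subset.trans Set.inter_subset_right
  refine ⟨closure (Subtype.val '' V), isClosed_closure, (hB.image _).closure, fun ε => ?_⟩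
  refine closure_minimal ?_ isClosed_closure
  rintro _ ⟨x, hx, rfl⟩
  -- A fibre whose closure contains the open set `V` has a dense trace on `V`.
  have h1 : x ∈ closure (V ∩ F.domRestrict f ⁻¹' {ε}) :=
    hVo.inter_closure ⟨hx, hVε ε hx⟩
  refine closure_mono ?_ (image_closure_subset_closure_image continuous_subtype_val ⟨x, h1, rfl⟩)
  rintro _ ⟨y, ⟨hy, hyε⟩, rfl⟩
  exact ⟨subset_closure ⟨y, hy, rfl⟩, hyε⟩

/-- A Cantor–Bendixson style argument: let `G` be the union of the basic sets inside which both
fibres are `G_δ`. By countability `G` has the same property. If its complement were nonempty, `f`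
would be constant on a relatively open piece of it, and a basic set cutting out such a piece would
already lie in `G`. -/
theorem isGδ_fibres_of_mem_BrSec {ℬ : Set (Set X)} (hℬ : TopologicalSpace.IsTopologicalBasis ℬ)
    (hcount : ℬ.Countable) (hclosed : ∀ V ∈ ℬ, IsClosed V) {f : X → Bool} (hf : f ∈ BrSec X)
    (ε : Bool) : IsGδ (f ⁻¹' {ε}) := by
  set 𝒢 : Set (Set X) := {V ∈ ℬ | ∀ ε, IsGδ (Vᶜ ∪ f ⁻¹' {ε})}
  set G : Set X := ⋃₀ 𝒢 with hG
  have hGo : IsOpen G := isOpen_sUnion fun V hV => hℬ.isOpen hV.1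
  have hGδ : ∀ ε, IsGδ (Gᶜ ∪ f ⁻¹' {ε}) := by
    intro ε
    have : Gᶜ ∪ f ⁻¹' {ε} = ⋂ V ∈ 𝒢, (Vᶜ ∪ f ⁻¹' {ε}) := by
      ext x
      simp only [hG, Set.mem_union, Set.mem_compl_iff, Set.mem_sUnion, Set.mem_iInter]
      grind
    rw [this]
    exact IsGδ.biInter (hcount.mono fun V hV => hV.1) fun V hV => hV.2 ε
  suffices hGu : Gᶜ = ∅ by simpa [hGu] using hGδ ε
  by_contra hne
  rw [← ne_eq, ← Set.nonempty_iff_ne_empty] at hne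
  have hB := hf Gᶜ hGo.isClosed_compl hne
  rw [BSec, Set.mem_ofPred_eq] at hB
  obtain ⟨x, ε, hx⟩ : ∃ x : ↥Gᶜ, ∃ ε, x ∉ closure (Gᶜ.domRestrict f ⁻¹' {ε}) := by
    by_contra! h
    have : closure (Gᶜ.domRestrict f ⁻¹' {false}) ∩ closure (Gᶜ.domRestrict f ⁻¹' {true}) =
        Set.univ := Set.eq_univ_of_forall fun x => ⟨h x _, h x _⟩
    rw [this, interior_univ] at hB
    exact Set.eq_empty_iff_forall_notMem.1 hB ⟨hne.some, hne.some_mem⟩ trivial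
  obtain ⟨O, hO, hOx⟩ := isOpen_induced_iff.1
    (isClosed_closure (s := Gᶜ.domRestrict f ⁻¹' {ε})).isOpen_compl
  have hxO : x.1 ∈ O := by
    change x ∈ Subtype.val ⁻¹' O
    rw [hOx]; exact hx
  obtain ⟨V, hV, hxV, hVO⟩ := hℬ.exists_subset_of_mem_open hxO hO
  have hVf : ∀ y ∈ V, y ∉ G → f y ≠ ε := by
    intro y hy hyG hyε
    have : (⟨y, hyG⟩ : ↥Gᶜ) ∈ Subtype.val ⁻¹' O := hVO hy
    rw [hOx] at this
    exact this (subset_closure hyε)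
  have hVc : IsGδ Vᶜ := (hclosed V hV).isOpen_compl.isGδ
  refine x.2 ⟨V, ⟨hV, fun δ => ?_⟩, hxV⟩
  by_cases hδ : δ = ε
  -- Inside `V` the `ε`-fibre lies in the open set `G`; the other fibre contains all of `V` outside
  -- `G`.
  · have : Vᶜ ∪ f ⁻¹' {δ} = (Vᶜ ∪ (Gᶜ ∪ f ⁻¹' {δ})) ∩ (Vᶜ ∪ G) := by
      ext y
      simp only [Set.mem_union, Set.mem_compl_iff, Set.mem_inter_iff, Set.mem_preimage,
        Set.mem_singleton_iff]
      grind
    rw [this]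
    exact (hVc.union (hGδ δ)).inter (hVc.union hGo.isGδ)
  · have : Vᶜ ∪ f ⁻¹' {δ} = Vᶜ ∪ (Gᶜ ∪ f ⁻¹' {δ}) := by
      ext y
      have hor : f y ≠ ε → f y = δ := by
        cases δ <;> cases ε <;> cases f y <;> simp_all
      simp only [Set.mem_union, Set.mem_compl_iff, Set.mem_preimage,
        Set.mem_singleton_iff]
      grind
    rw [this]
    exact hVc.union (hGδ δ)

end Topology

/-! ### Realizing types and conjugating their realizations. -/

section Saturation

open FirstOrder.Language

variable {L : FirstOrder.Language.{u, v}} {U : Type w} [L.Structure U]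

/-- Trading constants for variables lets saturation be used without leaving the language `L`. -/
theorem IsSaturatedAbove.exists_realize {κ : Cardinal.{w}} (hU : IsSaturatedAbove L U κ)
    {α K : Type*} {n : ℕ} (e : α → U) (he : #(Set.range e) ≤ κ)
    (ψ : K → L.Formula (α ⊕ Fin n))
    (h : ∀ t : Finset K, ∃ c : Fin n → U, ∀ k ∈ t, (ψ k).Realize (Sum.elim e c)) :
    ∃ c : Fin n → U, ∀ k, (ψ k).Realize (Sum.elim e c) := by
  classical
  let θ : K → L[[Set.range e]].Formula (Fin n) := fun k =>
    BoundedFormula.constantsVarsEquiv.symm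
      ((ψ k).relabel (Sum.map (Set.rangeFactorization e) id))
  have hθ : ∀ k (c : Fin n → U), (θ k).Realize c ↔ (ψ k).Realize (Sum.elim e c) := by
    intro k c
    rw [Formula.Realize, ← BoundedFormula.realize_constantsVarsEquiv, Equiv.apply_symm_apply,
      ← Formula.Realize, Formula.realize_relabel]
    refine iff_of_eq (congrArg _ ?_)
    ext (i | i) <;> rfl
  obtain ⟨c, hc⟩ := hU (Set.range e) he n (Set.range θ) fun S₀ hS₀ => by
    obtain ⟨t, rfl⟩ : ∃ t : Finset K, t.image θ = S₀ := by
      obtain ⟨t, -, ht⟩ := Finset.subset_set_image_iff.1 (Set.image_univ (f := θ) ▸ hS₀)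
      exact ⟨t, ht⟩
    obtain ⟨c, hc⟩ := h t
    refine ⟨c, fun χ hχ => ?_⟩
    obtain ⟨k, hk, rfl⟩ := Finset.mem_image.1 hχ
    exact (hθ k c).2 (hc k hk)
  exact ⟨c, fun k => (hθ k c).1 (hc _ ⟨k, rfl⟩)⟩

/-- Sentences with constants for `A` and for `n` variables, as formulas in variables `A ⊕ Fin n`. -/
noncomputable def sentenceEquivFormula (A : Set U) (n : ℕ) :
    L[[A]][[Fin n]].Sentence ≃ L.Formula (A ⊕ Fin n) :=
  Formula.equivSentence.symm.trans BoundedFormula.constantsVarsEquiv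

variable [Nonempty U]

theorem mem_tpOver_iff {A : Set U} {n : ℕ} {b : Fin n → U} {χ : L[[A]][[Fin n]].Sentence} :
    χ ∈ tpOver L A b ↔
      (sentenceEquivFormula A n χ).Realize (Sum.elim (Subtype.val : A → U) b) := by
  rw [tpOver, Theory.CompleteType.mem_typeOf, Formula.Realize,
    ← BoundedFormula.realize_constantsVarsEquiv]
  rfl

theorem tpOver_eq_of_forall_mem {A : Set U} {n : ℕ} {b : Fin n → U} {q : TypesOver L A n}
    (h : ∀ χ ∈ q, χ ∈ tpOver L A b) : tpOver L A b = q := by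
  refine SetLike.ext fun χ => ⟨fun hχ => ?_, h χ⟩
  by_contra hq
  exact (Theory.CompleteType.not_mem_iff _ _).1 (h _ ((Theory.CompleteType.not_mem_iff q χ).2 hq))
    hχ

/-- The existential closure of the finite conjunction is a sentence true in a model realizing `q`,
hence in `U` since the theory is complete. -/
theorem exists_forall_mem_tpOver {A : Set U} {n : ℕ} (q : TypesOver L A n)
    (t : Finset (L[[A]][[Fin n]].Sentence)) (ht : ∀ χ ∈ t, χ ∈ q) :
    ∃ b : Fin n → U, ∀ χ ∈ t, χ ∈ tpOver L A b := by
  obtain ⟨N, v, rfl⟩ := Theory.exists_modelType_is_realized_in _ q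
  let θ : t → L[[A]].Formula (Fin n) := fun χ => Formula.equivSentence.symm χ.1
  let σ : L[[A]].Sentence :=
    ((Formula.iInf θ).relabel (Sum.inr : Fin n → Empty ⊕ Fin n)).iExs (Fin n)
  have hN : N ⊨ σ := by
    refine Formula.realize_iExs.2 ⟨v, ?_⟩
    rw [Formula.realize_relabel, Formula.realize_iInf]
    exact fun χ => Theory.CompleteType.mem_typeOf.1 (ht χ.1 χ.2)
  have hUσ : U ⊨ σ := (realize_iff_of_model_completeTheory U N σ).1 hN
  obtain ⟨b, hb⟩ := Formula.realize_iExs.1 hUσ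
  rw [Formula.realize_relabel, Formula.realize_iInf] at hb
  exact ⟨b, fun χ hχ => Theory.CompleteType.mem_typeOf.2 (hb ⟨χ, hχ⟩)⟩

/-- A type over `A` together with a pattern of `φ` on countably many tuples is realized as soon as
it is finitely satisfiable. -/
theorem IsSaturatedAbove.exists_tpOver_eq_and_pattern {κ : Cardinal.{w}}
    (hU : IsSaturatedAbove L U κ) (hκ : ℵ₀ ≤ κ) {A : Set U} (hA : #A ≤ κ) {m n : ℕ}
    (φ : L.Formula (Fin m ⊕ Fin n)) (q : TypesOver L A n) {C : Set (Fin m → U)}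
    (hC : C.Countable) (I : Set (Fin m → U))
    (h : ∀ (t : Finset (L[[A]][[Fin n]].Sentence)) (s : Finset (Fin m → U)),
      (∀ χ ∈ t, χ ∈ q) → (s : Set (Fin m → U)) ⊆ C →
      ∃ b : Fin n → U, (∀ χ ∈ t, χ ∈ tpOver L A b) ∧
        ∀ a ∈ s, φ.Realize (Sum.elim a b) ↔ a ∈ I) :
    ∃ b : Fin n → U, tpOver L A b = q ∧ ∀ a ∈ C, φ.Realize (Sum.elim a b) ↔ a ∈ I := by
  classical
  let e : A ⊕ (C × Fin m) → U := Sum.elim Subtype.val fun c => c.1.1 c.2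
  have he : #(Set.range e) ≤ κ := by
    have : Set.range e = A ∪ Set.range fun c : C × Fin m => c.1.1 c.2 := by
      rw [Set.Sum.elim_range, Subtype.range_coe]
    rw [this]
    have : Countable C := hC
    refine (mk_union_le _ _).trans (add_le_of_le hκ hA ?_)
    exact (Set.countable_range _).le_aleph0.trans hκ
  let ψ : ({χ // χ ∈ q} ⊕ C) → L.Formula ((A ⊕ (C × Fin m)) ⊕ Fin n) :=
    Sum.elim (fun χ => (sentenceEquivFormula A n χ.1).relabel (Sum.map Sum.inl id))
      fun a =>
        let θ := φ.relabel (Sum.map (fun i => Sum.inr (a, i)) id)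
        if a.1 ∈ I then θ else θ.not
  have hψl : ∀ (χ : {χ // χ ∈ q}) (b : Fin n → U),
      (ψ (Sum.inl χ)).Realize (Sum.elim e b) ↔ χ.1 ∈ tpOver L A b := by
    intro χ b
    rw [mem_tpOver_iff]
    simp only [ψ, Sum.elim_inl, Formula.realize_relabel]
    refine iff_of_eq (congrArg _ ?_)
    ext (i | i) <;> rfl
  have hψr : ∀ (a : C) (b : Fin n → U),
      (ψ (Sum.inr a)).Realize (Sum.elim e b) ↔ (φ.Realize (Sum.elim a.1 b) ↔ a.1 ∈ I) := by
    intro a b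
    have hθ : (φ.relabel (Sum.map (fun i => Sum.inr (a, i)) id) :
        L.Formula ((A ⊕ (C × Fin m)) ⊕ Fin n)).Realize (Sum.elim e b) ↔
        φ.Realize (Sum.elim a.1 b) := by
      rw [Formula.realize_relabel]
      refine iff_of_eq (congrArg _ ?_)
      ext (i | i) <;> rfl
    by_cases ha : a.1 ∈ I <;> simp [ψ, ha, hθ]
  obtain ⟨b, hb⟩ := hU.exists_realize e he ψ fun t => by
    obtain ⟨b, hb₁, hb₂⟩ := h (t.toLeft.image Subtype.val) (t.toRight.image Subtype.val)
      (by simp +contextual) (by simp +contextual [Set.subset_def])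
    refine ⟨b, ?_⟩
    rintro (χ | a) hk
    · exact (hψl χ b).2 (hb₁ _ (Finset.mem_image_of_mem _ (Finset.mem_toLeft.2 hk)))
    · exact (hψr a b).2 (hb₂ _ (Finset.mem_image_of_mem _ (Finset.mem_toRight.2 hk)))
  exact ⟨b, tpOver_eq_of_forall_mem fun χ hχ => (hψl ⟨χ, hχ⟩ b).1 (hb _),
    fun a ha => (hψr ⟨a, ha⟩ b).1 (hb _)⟩

theorem IsSaturatedAbove.exists_tpOver_eq {κ : Cardinal.{w}}
    (hU : IsSaturatedAbove L U κ) (hκ : ℵ₀ ≤ κ) {A : Set U} (hA : #A ≤ κ) {n : ℕ}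
    (q : TypesOver L A n) : ∃ b : Fin n → U, tpOver L A b = q := by
  -- With no tuples to constrain, the formula is irrelevant.
  obtain ⟨b, hb, -⟩ := hU.exists_tpOver_eq_and_pattern hκ hA (⊥ : L.Formula (Fin 0 ⊕ Fin n)) q
    Set.countable_empty ∅ fun t s ht hs => by
      obtain ⟨b, hb⟩ := exists_forall_mem_tpOver q t ht
      exact ⟨b, hb, fun a ha => (hs ha).elim⟩
  exact ⟨b, hb⟩

theorem IsStronglyHomogeneousAbove.exists_equiv_of_tpOver_eq {κ : Cardinal.{w}}
    (hU : IsStronglyHomogeneousAbove L U κ) (hκ : ℵ₀ ≤ κ) {A : Set U} (hA : #A ≤ κ) {n : ℕ}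
    {b b' : Fin n → U} (h : tpOver L A b = tpOver L A b') :
    ∃ σ : U ≃[L] U, (∀ a ∈ A, σ a = a) ∧ σ ∘ b = b' := by
  obtain ⟨σ, hσ⟩ := hU (A ⊕ Fin n)
    (by
      rw [mk_sum, lift_id', mk_fin, lift_natCast]
      exact add_le_of_le hκ (by simpa using hA) ((natCast_lt_aleph0).le.trans hκ))
    (Sum.elim Subtype.val b) (Sum.elim Subtype.val b') fun ψ => by
      obtain ⟨χ, rfl⟩ := (sentenceEquivFormula A n).surjective ψ
      rw [← mem_tpOver_iff, ← mem_tpOver_iff, h]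
  exact ⟨σ, fun a ha => hσ (Sum.inl ⟨a, ha⟩), funext fun i => hσ (Sum.inr i)⟩

end Saturation

/-! ### Shattering from dense fibres. -/

section Types

open FirstOrder.Language

variable {L : FirstOrder.Language.{u, v}} {U : Type w}

theorem card_withConstants_sentence_le {κ : Cardinal.{w}} (hκ : ℵ₀ ≤ κ)
    (hL : Cardinal.lift.{w} L.card ≤ Cardinal.lift.{max u v} κ) {A : Set U} (hA : #A ≤ κ) (n : ℕ) :
    #(L[[A]][[Fin n]].Sentence) ≤ Cardinal.lift.{max u v} κ := by
  have hκ' : ℵ₀ ≤ Cardinal.lift.{max u v} κ := aleph0_le_lift.2 hκ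
  have h1 : #(L[[A]][[Fin n]].Sentence) ≤ #(Σ k, L[[A]][[Fin n]].BoundedFormula Empty k) :=
    mk_le_of_injective (f := fun χ => ⟨0, χ⟩) fun _ _ h => by simpa using h
  refine h1.trans (BoundedFormula.card_le.trans (max_le hκ' ?_))
  simp only [mk_eq_zero, lift_zero, zero_add, card_withConstants, mk_fin, lift_natCast,
    lift_uzero]
  refine add_le_of_le hκ' (add_le_of_le hκ' ?_ ?_) ((natCast_lt_aleph0).le.trans hκ')
  · exact hL
  · exact lift_le.2 hA

variable [L.Structure U]

theorem PhiType.exists_realize_iff_entails {κ : Cardinal.{w}} (hU : IsSaturatedAbove L U κ)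
    {m n : ℕ} {φ : L.Formula (Fin m ⊕ Fin n)} (p : PhiType φ U) {J : Type*} (b : J → Fin n → U)
    (hb : #(Set.range fun i : J × Fin n => b i.1 i.2) ≤ κ) :
    ∃ a : Fin m → U, ∀ j, φ.Realize (Sum.elim a (b j)) ↔ p.Entails (b j) := by
  classical
  let ψ : J → L.Formula ((J × Fin n) ⊕ Fin m) := fun j =>
    let θ := φ.relabel (Sum.elim Sum.inr fun i => Sum.inl (j, i))
    if p.Entails (b j) then θ else θ.not
  have hψ : ∀ j (a : Fin m → U),
      (ψ j).Realize (Sum.elim (fun i : J × Fin n => b i.1 i.2) a) ↔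
        (φ.Realize (Sum.elim a (b j)) ↔ p.Entails (b j)) := by
    intro j a
    have hθ : (φ.relabel (Sum.elim Sum.inr fun i => Sum.inl (j, i)) :
        L.Formula ((J × Fin n) ⊕ Fin m)).Realize
          (Sum.elim (fun i : J × Fin n => b i.1 i.2) a) ↔ φ.Realize (Sum.elim a (b j)) := by
      rw [Formula.realize_relabel]
      refine iff_of_eq (congrArg _ ?_)
      ext (i | i) <;> rfl
    by_cases h : p.Entails (b j) <;> simp [ψ, h, hθ]
  obtain ⟨a, ha⟩ := hU.exists_realize _ hb ψ fun t => by
    obtain ⟨a, ha⟩ := p.consistent (t.image fun j => (b j, decide (p.Entails (b j)))) fun c hc => by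
      obtain ⟨j, -, rfl⟩ := Finset.mem_image.1 (Finset.mem_coe.1 hc)
      by_cases h : p.Entails (b j)
      · simp only [h, decide_true]
        exact h
      · simpa [h] using (p.complete (b j)).resolve_left h
    exact ⟨a, fun j hj => (hψ j a).2 (by simpa using ha _ (Finset.mem_image_of_mem _ hj))⟩
  exact ⟨a, fun j => (hψ j a).1 (ha j)⟩

theorem countable_range_typesWith (hL : L.card ≤ ℵ₀) {A : Set U} (hA : #A ≤ ℵ₀) (n : ℕ) :
    (Set.range ((L[[A]].completeTheory U).typesWith (α := Fin n))).Countable := by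
  have h := card_withConstants_sentence_le le_rfl (by simpa using hL) hA n
  rw [lift_aleph0] at h
  have : Countable (L[[A]][[Fin n]].Sentence) := mk_le_aleph0_iff.1 h
  exact Set.countable_range _

variable [Nonempty U]

/-- Every pattern of `φ` on the finite set `s` is compatible with every type in `G`. -/
def PatternsCompatible {m n : ℕ} (φ : L.Formula (Fin m ⊕ Fin n)) {A : Set U}
    (G : Set (TypesOver L A n)) (s : Finset (Fin m → U)) : Prop :=
  ∀ I : Set (Fin m → U), ∀ q ∈ G, ∃ b : Fin n → U, tpOver L A b = q ∧
    ∀ a ∈ s, φ.Realize (Sum.elim a b) ↔ a ∈ I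

-- For each finite part of a type, each pattern on `s` and each truth value `ε`, one tuple `b` is
-- fixed with `p` entailing `φ(x; b)` exactly when `ε` is true. There are at most `κ` of these, so
-- some `a` realizes `p` on all of them, and choosing `ε` decides `φ(a; b)` independently of the
-- pattern on `s`.
open Classical in
theorem PatternsCompatible.exists_insert {κ : Cardinal.{w}} (hU : IsSaturatedAbove L U κ)
    (hκ : ℵ₀ ≤ κ) (hL : Cardinal.lift.{w} L.card ≤ Cardinal.lift.{max u v} κ) {A : Set U}
    (hA : #A ≤ κ) {m n : ℕ} {φ : L.Formula (Fin m ⊕ Fin n)} (p : PhiType φ U)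
    {f : TypesOver L A n → Bool} (hf : ∀ b, f (tpOver L A b) = true ↔ p.Entails b)
    {G : Set (TypesOver L A n)} (hne : G.Nonempty) (hG : ∀ ε, G ⊆ closure (G ∩ f ⁻¹' {ε}))
    {s : Finset (Fin m → U)} (hs : PatternsCompatible φ G s) :
    ∃ a ∉ s, PatternsCompatible φ G (insert a s) := by
  let J := List (L[[A]][[Fin n]].Sentence) × Set s × Bool
  let Good : J → (Fin n → U) → Prop := fun j b =>
    (∀ χ ∈ j.1, χ ∈ tpOver L A b) ∧ (∀ a : s, φ.Realize (Sum.elim a.1 b) ↔ a ∈ j.2.1) ∧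
      (p.Entails b ↔ j.2.2 = true)
  have hGood : ∀ (l : List (L[[A]][[Fin n]].Sentence)) (I : Set (Fin m → U)) (ε : Bool),
      ∀ q ∈ G, (∀ χ ∈ l, χ ∈ q) → ∃ b, Good (l, {a | a.1 ∈ I}, ε) b := by
    intro l I ε q hq hl
    have hO : IsOpen {r : TypesOver L A n | ∀ χ ∈ l, χ ∈ r} := by
      have : {r : TypesOver L A n | ∀ χ ∈ l, χ ∈ r} =
          ⋂ χ ∈ l.toFinset, (L[[A]].completeTheory U).typesWith χ := by
        ext r; simp
      rw [this]
      exact isOpen_biInter_finset fun χ _ => CompleteType.isOpen_typesWith χ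
    obtain ⟨r, hr, hrG, hrε⟩ := mem_closure_iff.1 (hG ε hq) _ hO hl
    obtain ⟨b, rfl, hb⟩ := hs I r hrG
    refine ⟨b, hr, fun a => hb a.1 a.2, ?_⟩
    rw [← hf, show f (tpOver L A b) = ε from hrε]
  -- Indices without a good tuple receive an arbitrary one, which is harmless.
  let b : J → Fin n → U := fun j => Classical.epsilon (Good j)
  have hcard : #(Set.range fun i : J × Fin n => b i.1 i.2) ≤ κ := by
    have hκ' : ℵ₀ ≤ Cardinal.lift.{max u v} κ := aleph0_le_lift.2 hκ
    refine lift_le.{max u v}.1 ?_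
    have h1 := mk_range_le_lift (f := fun i : J × Fin n => b i.1 i.2)
    rw [lift_umax.{w, max u v}, lift_id'.{w, max u v w}] at h1
    refine h1.trans ?_
    simp only [J, mk_prod, mk_fin, lift_natCast, lift_lift, lift_mul, lift_uzero]
    refine mul_le_of_le hκ' (mul_le_of_le hκ' ?_ (mul_le_of_le hκ' ?_ ?_)) ?_
    · rw [lift_id'.{w, max u v w}]
      exact (mk_list_le_max _).trans
        (max_le hκ' (card_withConstants_sentence_le hκ hL hA n))
    · exact (lift_le_aleph0.2 mk_le_aleph0).trans hκ'
    · exact (lift_le_aleph0.2 mk_le_aleph0).trans hκ'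
    · exact (natCast_lt_aleph0).le.trans hκ'
  obtain ⟨a, ha⟩ := p.exists_realize_iff_entails hU b hcard
  have key : ∀ (l : List (L[[A]][[Fin n]].Sentence)) (I : Set (Fin m → U)),
      ∀ q ∈ G, (∀ χ ∈ l, χ ∈ q) → ∃ b, (∀ χ ∈ l, χ ∈ tpOver L A b) ∧
        ∀ c ∈ insert a s, φ.Realize (Sum.elim c b) ↔ c ∈ I := by
    intro l I q hq hl
    obtain ⟨h₁, h₂, h₃⟩ := Classical.epsilon_spec (hGood l I (decide (a ∈ I)) q hq hl)
    refine ⟨_, h₁, fun c hc => ?_⟩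
    obtain rfl | hc := Finset.mem_insert.1 hc
    · exact (ha (l, {a | a.1 ∈ I}, decide (c ∈ I))).trans (h₃.trans (by simp))
    · exact h₂ ⟨c, hc⟩
  refine ⟨a, fun has => ?_, fun I q hq => ?_⟩
  -- The tuple for the full pattern on `s` and `ε = false` satisfies `φ(c; b)` for all `c` in `s`,
  -- but not `φ(a; b)`.
  · obtain ⟨q, hq⟩ := hne
    obtain ⟨-, h₂, h₃⟩ := Classical.epsilon_spec (hGood [] Set.univ false q hq (by simp))
    have h := ha ([], {a : s | a.1 ∈ Set.univ}, false)
    exact absurd (h₃.1 (h.1 ((h₂ ⟨a, has⟩).2 trivial))) (by simp)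
  · refine hU.exists_tpOver_eq_and_pattern hκ hA φ q (Finset.countable_toSet _) I
      fun t s' ht hs' => ?_
    obtain ⟨b, hb₁, hb₂⟩ := key t.toList I q hq (by simpa using ht)
    exact ⟨b, by simpa using hb₁, fun c hc => hb₂ c (hs' hc)⟩

open Classical in
theorem IsNIP.mem_BrSec {κ : Cardinal.{w}} (hU : IsSaturatedAbove L U κ)
    (hκ : ℵ₀ ≤ κ) (hL : Cardinal.lift.{w} L.card ≤ Cardinal.lift.{max u v} κ) {A : Set U}
    (hA : #A ≤ κ) {m n : ℕ} {φ : L.Formula (Fin m ⊕ Fin n)} (hφ : IsNIP φ U) (p : PhiType φ U)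
    {f : TypesOver L A n → Bool} (hf : ∀ b, f (tpOver L A b) = true ↔ p.Entails b) :
    f ∈ BrSec (TypesOver L A n) := by
  by_contra hB
  obtain ⟨G, -, hne, hG⟩ := exists_isClosed_dense_fibres_of_notMem_BrSec hB
  have hstep : ∀ s : {s : Finset (Fin m → U) // PatternsCompatible φ G s},
      ∃ t : {s : Finset (Fin m → U) // PatternsCompatible φ G s}, s < t := by
    rintro ⟨s, hs⟩
    obtain ⟨a, has, ha⟩ := hs.exists_insert hU hκ hL hA p hf hne hG
    exact ⟨⟨_, ha⟩, Finset.ssubset_insert has⟩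
  choose g hg using hstep
  have h₀ : PatternsCompatible φ G ∅ := fun I q _ => by
    obtain ⟨b, hb⟩ := hU.exists_tpOver_eq hκ hA q
    exact ⟨b, hb, by simp⟩
  let F : ℕ → {s : Finset (Fin m → U) // PatternsCompatible φ G s} :=
    fun k => g^[k] ⟨∅, h₀⟩
  have hF : StrictMono F := strictMono_nat_of_lt_succ fun k => by
    simp only [F, Function.iterate_succ_apply']
    exact hg _
  let C : Set (Fin m → U) := ⋃ k, ((F k).1 : Set (Fin m → U))
  refine hφ ⟨C, fun hfin => ?_, fun I hI => ?_⟩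
  -- A finite `C` would have infinitely many subsets, namely the distinct finite stages.
  · refine Set.infinite_of_injective_forall_mem (s := (hfin.toFinset.powerset : Set (Finset _)))
      (Subtype.val_injective.comp hF.injective) (fun k => ?_) (Finset.finite_toSet _)
    simp only [Finset.coe_powerset, Set.mem_preimage, Set.mem_powerset_iff, Set.Finite.coe_toFinset,
      Function.comp_apply]
    exact Set.subset_iUnion (fun k => ((F k).1 : Set (Fin m → U))) k
  · obtain ⟨q, hq⟩ := hne
    obtain ⟨b, -, hb⟩ := hU.exists_tpOver_eq_and_pattern hκ hA φ q
      (Set.countable_iUnion fun k => Finset.countable_toSet (F k).1) I fun t s ht hs => by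
        have hmono : Monotone fun k => ((F k).1 : Set (Fin m → U)) :=
          fun _ _ h => Finset.coe_subset.2 (hF.monotone h)
        obtain ⟨k, hk⟩ := hmono.directed_le.exists_mem_subset_of_finset_subset_biUnion hs
        obtain ⟨b, hb, hb'⟩ := (F k).2 I q hq
        exact ⟨b, fun χ hχ => hb ▸ ht χ hχ, fun a ha => hb' a (hk ha)⟩
    exact ⟨b, hb⟩

end Types

/-! ### The three conclusions. -/

theorem mainTheorem1 {L : FirstOrder.Language.{u, v}} {U : Type w} [L.Structure U] [Nonempty U]
    (κ : Cardinal.{w}) (hκ : ℵ₀ ≤ κ)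
    (hL : Cardinal.lift.{w} L.card ≤ Cardinal.lift.{max u v} κ)
    (hU : IsMonster L U κ)
    (M : L.ElementarySubstructure U) (hM : #M ≤ κ)
    {m n : ℕ} (φ : L.Formula (Fin m ⊕ Fin n)) (hφ : IsNIP φ U)
    (p : PhiType φ U) (hp : p.IsInvariant (M : Set U)) :
    (∀ q : TypesOver L (M : Set U) n,
      (∃ b : Fin n → U, tpOver L (M : Set U) b = q) ∧
        ∀ b : Fin n → U, tpOver L (M : Set U) b = q →
          (p.defFun (M : Set U) q = true ↔ p.Entails b)) ∧
    p.defFun (M : Set U) ∈ BrSec (TypesOver L (M : Set U) n) ∧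
    (L.card ≤ ℵ₀ → #M ≤ ℵ₀ →
      IsFSigma {q : TypesOver L (M : Set U) n |
          ∃ b : Fin n → U, tpOver L (M : Set U) b = q ∧ p.Entails b} ∧
        IsGδ {q : TypesOver L (M : Set U) n |
          ∃ b : Fin n → U, tpOver L (M : Set U) b = q ∧ p.Entails b}) := by
  have hdef : ∀ b : Fin n → U,
      p.defFun (M : Set U) (tpOver L (M : Set U) b) = true ↔ p.Entails b := by
    intro b
    simp only [PhiType.defFun, decide_eq_true_eq]
    refine ⟨?_, fun h => ⟨b, rfl, h⟩⟩
    rintro ⟨b', hb', h⟩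
    -- Two realizations of the same type are conjugate over `M`, and `p` is invariant.
    obtain ⟨σ, hσ, rfl⟩ := hU.homogeneous.exists_equiv_of_tpOver_eq hκ hM hb'
    exact (hp σ hσ b' true).1 h
  have hBr : p.defFun (M : Set U) ∈ BrSec (TypesOver L (M : Set U) n) :=
    hφ.mem_BrSec hU.saturated hκ hL hM p hdef
  refine ⟨fun q => ⟨hU.saturated.exists_tpOver_eq hκ hM q, ?_⟩, hBr, fun hL' hM' => ?_⟩
  · rintro b rfl
    exact hdef b
  · have hδ := isGδ_fibres_of_mem_BrSec CompleteType.isTopologicalBasis_range_typesWith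
      (countable_range_typesWith hL' hM' n)
      (Set.forall_mem_range.2 CompleteType.isClosed_typesWith) hBr
    have htrue : {q : TypesOver L (M : Set U) n |
        ∃ b : Fin n → U, tpOver L (M : Set U) b = q ∧ p.Entails b} =
        p.defFun (M : Set U) ⁻¹' {true} := by
      ext q
      simp [PhiType.defFun]
    have hfalse : (p.defFun (M : Set U) ⁻¹' {true})ᶜ = p.defFun (M : Set U) ⁻¹' {false} := by
      ext q
      simp
    rw [htrue, isFSigma_iff_isGδ_compl, hfalse]
    exact ⟨hδ false, hδ true⟩
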